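/- **Conventions.** The set of reals is ${}^{\omega}2$ with the product topology. For a cardinal $\kappa$, a $(2,2,\kappa)$-tree is a set $T\subseteq\bigcup_{n<\omega}({}^{n}2\times{}^{n}2\times{}^{n}\kappa)$, and $\lim(T)$ is the set of $(\eta,\nu,\rho)\in{}^{\omega}2\times{}^{\omega}2\times{}^{\omega}\kappa$ with $(\eta\restriction n,\nu\restriction n,\rho\restriction n)\in T$ for all $n<\omega$. A relation $\varphi\subseteq{}^{\omega}2\times{}^{\omega}2$ is $\kappa$-Souslin if $\varphi=\{(\eta,\nu):(\exists\rho)\,(\eta,\nu,\rho)\in\lim(T)\}$ for some $(2,2,\kappa)$-tree $T$. A $(\lambda_1,\lambda_2)$-rectangle is a set $A_1\times A_2$ with $A_l\subseteq{}^{\omega}2$ and $|A_l|=\lambda_l$; a perfect rectangle is a set $P_1\times P_2$ with $P_1,P_2\subseteq{}^{\omega}2$ nonempty and perfect. **Rank.** Consider models $M$ with unary predicates $R_1,R_2,Q$ and a two-place function $F$ in the vocabulary $\tau(M)$, such that $R_1^M\cap R_2^M=\emptyset$ and $F^M$ maps $R^M_1\times R^M_2$ into $Q^M$. Let $[M]^{\otimes}$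 be the set of pairs $\bar w=(w_1,w_2)$ of finite nonempty sets $w_i\subseteq R_i^M$ such that $F^M$ is constant on $w_1\times w_2$. For $\bar w\in[M]^\otimes$, define "$\mathrm{rkrc}^1(\bar w,M)\ge\alpha$" by induction on the ordinal $\alpha$. It always holds for $\alpha=0$; for $\alpha$ limit it means $\mathrm{rkrc}^1(\bar w,M)\ge\beta$ for all $\beta<\alpha$. For $\alpha=\beta+1$, write $w_1\cup w_2=\{a_0,\dots,a_{n-1}\}$ without repetition; it means that for every $k<n$ and all quantifier free formulas $\psi_{p,q}(x,y)$ of the vocabulary of $M$ (for $p,q<n$ with $a_p\in R_1^M$, $a_q\in R_2^M$) such that $M\models\psi_{p,q}[a_p,a_q]$, there are $a^i_m\in M$ ($m<n$, $i<2$) such that: (a) with $w'_1$ the set of all $a^i_m$ for which $a_m\in R_1^M$, and $w'_2$ the set of all $a^i_m$ for which $a_m\in R^M_2$, we have $(w_1',w_2')\in[M]^\otimes$ and $\mathrm{rkrc}^1((w'_1,w'_2),M)\ge\beta$; (b) for $i<2$: $a^i_0,\dots,a^i_{n-1}$ are pairwise distinct, $a_m\in R_j^M$ implies $a^i_m\in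 R_j^M$ ($j=1,2$), and $M\models\psi_{p,q}[a^i_p,a^i_q]$ for all $p,q$ as above; (c) $a^0_k\ne a^1_k$, and $a^0_m=a^1_m$ whenever $a_m$ and $a_k$ do not lie in the same one of $R^M_1$, $R^M_2$; (d) $F^M(a^i_p,a^j_q)=F^M(a_p,a_q)$ whenever $a_p\in R_1^M$, $a_q\in R_2^M$ and $i,j<2$. Let $\mathrm{rkrc}^1(\bar w,M)$ be the largest $\alpha$ with $\mathrm{rkrc}^1(\bar w,M)\ge\alpha$, or $\infty$ if this holds for every $\alpha$. For $c\in Q^M$ let $\mathrm{rkrc}^1(M,c)=\sup\{\mathrm{rkrc}^1(\bar w,M)+1:\bar w\in[M]^\otimes,\ F^M(a,b)=c\text{ for all }a\in w_1,\ b\in w_2\}$. Let $\mathrm{Prrd}^1_\alpha(\lambda_1,\lambda_2;\kappa,\theta)$ mean: for every such model $M$ with $|\tau(M)|\le\kappa$, $|R^M_1|=\lambda_1$, $|R^M_2|=\lambda_2$ and $|Q^M|=\theta$, there is $c\in Q^M$ with $\mathrm{rkrc}^1(M,c)\ge\alpha$. **Claim.** Let $\kappa,\theta,\lambda_1,\lambda_2$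 be cardinals with $\kappa$ infinite. Let $\varphi\subseteq{}^{\omega}2\times{}^{\omega}2$ be a union $\bigcup_{i<\theta}\varphi_i$, where each $\varphi_i$ is $\kappa$-Souslin. Suppose that $\varphi$ contains a $(\lambda_1,\lambda_2)$-rectangle and that $\mathrm{Prrd}^1_{\kappa^++1}(\lambda_1,\lambda_2;\kappa,\theta)$ holds. Then $\varphi$ contains a perfect rectangle. -/

import Mathlib

open Set Cardinal

universe u

namespace RectRank

/-- The set of reals `{}^ω 2`, with its product topology. -/
abbrev Real2 : Type := ℕ → Bool

/-- A `(2,2,κ)`-tree: a set of triples of finite sequences of a common length `n`, with entries in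
`2`, `2` and `κ` respectively (`κ` is identified with its initial ordinal). -/
abbrev Tree22 (κ : Cardinal.{u}) : Type u :=
  Set (Σ n : ℕ, (Fin n → Bool) × (Fin n → Bool) × (Fin n → κ.ord.ToType))

/-- `lim T`: the triples of infinite sequences all of whose restrictions lie in `T`. -/
def Tree22.lim {κ : Cardinal.{u}} (T : Tree22 κ) :
    Set (Real2 × Real2 × (ℕ → κ.ord.ToType)) :=
  {x | ∀ n : ℕ, (⟨n, fun i => x.1 i, fun i => x.2.1 i, fun i => x.2.2 i⟩ :
    Σ n : ℕ, (Fin n → Bool) × (Fin n → Bool) × (Fin n → κ.ord.ToType)) ∈ T}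

/-- A binary relation on the reals is `κ`-Souslin if it is the projection of `lim T` for some
`(2,2,κ)`-tree `T`. -/
def IsSouslin (κ : Cardinal.{u}) (φ : Set (Real2 × Real2)) : Prop :=
  ∃ T : Tree22 κ, φ = {p | ∃ ρ : ℕ → κ.ord.ToType, (p.1, p.2, ρ) ∈ T.lim}

/-- `φ` contains a `(lam₁, lam₂)`-rectangle. -/
def ContainsRectangle (lam₁ lam₂ : Cardinal.{u}) (φ : Set (Real2 × Real2)) : Prop :=
  ∃ A₁ A₂ : Set Real2,
    Cardinal.lift.{u} #A₁ = lam₁ ∧ Cardinal.lift.{u} #A₂ = lam₂ ∧ A₁ ×ˢ A₂ ⊆ φ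

/-- `φ` contains a perfect rectangle: a product of two nonempty perfect sets. -/
def ContainsPerfectRectangle (φ : Set (Real2 × Real2)) : Prop :=
  ∃ P₁ P₂ : Set Real2,
    Perfect P₁ ∧ P₁.Nonempty ∧ Perfect P₂ ∧ P₂.Nonempty ∧ P₁ ×ˢ P₂ ⊆ φ

/-- The distinguished symbols of a vocabulary: unary predicates `R₁`, `R₂`, `Q` and a two-place
function symbol `F`. -/
structure Symbols (L : FirstOrder.Language.{u, u}) where
  R₁ : L.Relations 1
  R₂ : L.Relations 1
  Q : L.Relations 1
  F : L.Functions 2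

section Model

variable {L : FirstOrder.Language.{u, u}} (S : Symbols L) (M : Type u) [L.Structure M]

/-- The interpretation of `R₁`. -/
def Symbols.r₁ : Set M := {a | FirstOrder.Language.Structure.RelMap S.R₁ ![a]}

/-- The interpretation of `R₂`. -/
def Symbols.r₂ : Set M := {a | FirstOrder.Language.Structure.RelMap S.R₂ ![a]}

/-- The interpretation of `Q`. -/
def Symbols.q : Set M := {a | FirstOrder.Language.Structure.RelMap S.Q ![a]}

variable {M}

/-- The interpretation of `F`. -/
def Symbols.f (a b : M) : M := FirstOrder.Language.Structure.funMap S.F ![a, b]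

/-- The pairs `(w₁, w₂)` of finite nonempty sets `wᵢ ⊆ Rᵢ` such that `F` is constant with value `c`
on `w₁ × w₂`. -/
def HomogAt (c : M) (w₁ w₂ : Set M) : Prop :=
  (w₁.Finite ∧ w₁.Nonempty ∧ w₁ ⊆ S.r₁ M) ∧ (w₂.Finite ∧ w₂.Nonempty ∧ w₂ ⊆ S.r₂ M) ∧
    ∀ a ∈ w₁, ∀ b ∈ w₂, S.f a b = c

/-- `[M]^⊗`: the pairs `(w₁, w₂)` of finite nonempty sets `wᵢ ⊆ Rᵢ` such that `F` is constant
on `w₁ × w₂`. -/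
def Homog (w₁ w₂ : Set M) : Prop := ∃ c : M, HomogAt S c w₁ w₂

/-- The successor step of the rank, for `ℓ = 1`; `P` is the predicate "rank at least `β`".
The elements of `w₁ ∪ w₂` serve as their own indices: `k` is the element to be split, `ψ a b` is
the quantifier free formula attached to the pair of variables with indices `a ∈ w₁`, `b ∈ w₂`,
and `e 0 m`, `e 1 m` are the two copies of `m ∈ w₁ ∪ w₂`. -/
def Step (P : Set M → Set M → Prop) (w₁ w₂ : Set M) : Prop :=
  ∀ k ∈ w₁ ∪ w₂, ∀ ψ : M → M → L.Formula (Fin 2),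
    (∀ a ∈ w₁, ∀ b ∈ w₂, (ψ a b).IsQF ∧ (ψ a b).Realize ![a, b]) →
    ∃ e : Fin 2 → M → M,
      P (⋃ i, e i '' w₁) (⋃ i, e i '' w₂) ∧
      (∀ i, InjOn (e i) (w₁ ∪ w₂) ∧ MapsTo (e i) w₁ (S.r₁ M) ∧ MapsTo (e i) w₂ (S.r₂ M) ∧
        ∀ a ∈ w₁, ∀ b ∈ w₂, (ψ a b).Realize ![e i a, e i b]) ∧
      (e 0 k ≠ e 1 k ∧ (k ∈ w₁ → ∀ m ∈ w₂, e 0 m = e 1 m) ∧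
        (k ∈ w₂ → ∀ m ∈ w₁, e 0 m = e 1 m)) ∧
      (∀ a ∈ w₁, ∀ b ∈ w₂, ∀ i j, S.f (e i a) (e j b) = S.f a b)

/-- `rkrc¹((w₁, w₂), M) ≥ α`, by recursion on the ordinal `α`. -/
noncomputable def RankGE (α : Ordinal.{u}) : Set M → Set M → Prop :=
  Ordinal.limitRecOn α
    (Homog S)
    (fun _ ih w₁ w₂ => Homog S w₁ w₂ ∧ Step S ih w₁ w₂)
    (fun δ _ ih w₁ w₂ => ∀ (β : Ordinal.{u}) (h : β < δ), ih β h w₁ w₂)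

/-- `rkrc¹((w₁, w₂), M)`, for `(w₁, w₂) ∈ [M]^⊗`: the largest `α` with `rkrc¹ ≥ α`, and `∞ = ⊤` if
this holds for every `α`. -/
noncomputable def rkrc (w₁ w₂ : Set M) : WithTop Ordinal.{u} :=
  sSup {x | ∃ α : Ordinal.{u}, x = (α : WithTop Ordinal.{u}) ∧ RankGE S α w₁ w₂}

/-- `rkrc¹(M, c)`, the supremum of `rkrc¹((w₁, w₂), M) + 1` over the pairs `(w₁, w₂) ∈ [M]^⊗` on
which the constant value of `F` is `c`. -/
noncomputable def rkrcAt (c : M) : WithTop Ordinal.{u} :=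
  sSup {x | ∃ w₁ w₂ : Set M, HomogAt S c w₁ w₂ ∧ x = rkrc S w₁ w₂ + 1}

variable (M)

/-- `|R₁| = lam₁`, `|R₂| = lam₂`, `R₁ ∩ R₂ = ∅`, `|Q| = θ` and `F` maps `R₁ × R₂` into `Q`. -/
structure IsRectModel (lam₁ lam₂ θ : Cardinal.{u}) : Prop where
  card_r₁ : #(S.r₁ M) = lam₁
  card_r₂ : #(S.r₂ M) = lam₂
  disj : Disjoint (S.r₁ M) (S.r₂ M)
  card_q : #(S.q M) = θ
  f_mem : ∀ a ∈ S.r₁ M, ∀ b ∈ S.r₂ M, S.f a b ∈ S.q M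

end Model

/-- `Prrd¹_α(lam₁, lam₂; θ₀, θ₁)`: every model with a vocabulary of at most `θ₀` symbols,
`|Rᵢ| = lamᵢ` and `F : R₁ × R₂ → Q`, `|Q| = θ₁`, has some `c ∈ Q` with `rkrc¹(M, c) ≥ α`. -/
def Prrd (α : Ordinal.{u}) (lam₁ lam₂ θ₀ θ₁ : Cardinal.{u}) : Prop :=
  ∀ (L : FirstOrder.Language.{u, u}) (S : Symbols L) (M : Type u) [L.Structure M],
    L.card ≤ θ₀ → IsRectModel S M lam₁ lam₂ θ₁ →
      ∃ c ∈ S.q M, (α : WithTop Ordinal.{u}) ≤ rkrcAt S c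

end RectRank

/-! Colour each point of a rectangle in `φ` by an `i` with the point in `Φ i`, and choose a branch
`ρ a b` witnessing this in the tree `T i`. Make the rectangle a model: `F` is the colouring, and
each triple `t` of finite sequences gets a binary relation saying that the point and its witness
restrict to `t`. There are only `κ` symbols, so some colour `i` carries a pair `W` of finite sets of
rank at least `κ⁺`.

The rest is a fusion inside colour `i`. For finite `W`, its approximation at `n` is the finite set
of triples restricted to `n`; only `κ` many exist. By regularity of `κ⁺`, one ordinal below `κ⁺`
bounds the ranks of all approximations not realized in every rank below `κ⁺`. Splitting a point from
a rank above that bound therefore leaves an approximation again realized in all these ranks, and the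
construction continues (`Large.exists_split`, `Large.exists_split_all`).

Along the resulting sequence both sides grow into perfect sets (`perfect_branches`). Since points of
a side are separated at each stage, the approximations also determine the witnesses coherently, and
their limit puts every point of the perfect rectangle in the projection of `lim (T i)`
(`exists_perfect_of_rank`). -/

namespace RectRank

/-! ### Perfect sets from sequences of finite approximations -/

/-- The reals which agree, for every `s`, with an element of `U s` below `n s`. -/
def branches (n : ℕ → ℕ) (U : ℕ → Set Real2) : Set Real2 :=
  {η | ∀ s, ∃ a ∈ U s, ∀ i < n s, η i = a i}

section Branches

variable {n : ℕ → ℕ} {U : ℕ → Set Real2}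

theorem isClosed_branches (hfin : ∀ s, (U s).Finite) : IsClosed (branches n U) := by
  have h : branches n U = ⋂ s, ⋃ a ∈ U s, ⋂ i, ⋂ (_ : i < n s), {η : Real2 | η i = a i} := by
    ext η
    simp [branches]
  rw [h]
  exact isClosed_iInter fun s => (hfin s).isClosed_biUnion fun a _ =>
    isClosed_iInter fun i => isClosed_iInter fun _ =>
      isClosed_eq (continuous_apply i) continuous_const

theorem exists_mem_branches_extending (hn : StrictMono n)
    (hres : ∀ s, ∀ a ∈ U (s + 1), ∃ b ∈ U s, ∀ i < n s, a i = b i)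
    (hext : ∀ s, ∀ a ∈ U s, ∃ b ∈ U (s + 1), ∀ i < n s, b i = a i)
    {s : ℕ} {a : Real2} (ha : a ∈ U s) :
    ∃ η ∈ branches n U, ∀ i < n s, η i = a i := by
  choose g hgU hg using hext
  let q : ∀ m : ℕ, U (s + m) :=
    fun m => Nat.rec ⟨a, ha⟩ (fun m b => ⟨g (s + m) b b.2, hgU (s + m) b b.2⟩) m
  have hq : ∀ m m', m ≤ m' → ∀ i < n (s + m), (q m').1 i = (q m).1 i := by
    intro m m' h
    induction m', h using Nat.le_induction with
    | base => intros; rfl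
    | succ k hk ih =>
      intro i hi
      rw [← ih i hi]
      exact hg (s + k) (q k).1 (q k).2 i (hi.trans_le (hn.monotone (by omega)))
  -- Stage `i + 1` has settled coordinate `i`, as `i < s + (i + 1) ≤ n (s + (i + 1))`, so the
  -- diagonal agrees with every `q m` below `n (s + m)`.
  have hη : ∀ m, ∀ i < n (s + m), (q (i + 1)).1 i = (q m).1 i := by
    intro m i hi
    rcases le_total m (i + 1) with h | h
    · exact hq _ _ h i hi
    · exact (hq _ _ h i (lt_of_lt_of_le (by omega) (hn.le_apply (x := s + (i + 1))))).symm
  refine ⟨fun i => (q (i + 1)).1 i, ?_, fun i hi => hη 0 i hi⟩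
  -- Stages before `s` are not on the sequence `q`; they are reached downwards by restriction.
  have hanti : Antitone fun t => ∃ b ∈ U t, ∀ i < n t, (q (i + 1)).1 i = b i := by
    refine antitone_nat_of_succ_le fun t => ?_
    rintro ⟨b, hb, h⟩
    obtain ⟨c, hc, hbc⟩ := hres t b hb
    exact ⟨c, hc, fun i hi => (h i (hi.trans (hn t.lt_succ_self))).trans (hbc i hi)⟩
  exact fun t => hanti (Nat.le_add_left t s) ⟨(q t).1, (q t).2, hη t⟩

theorem perfect_branches (hn : StrictMono n) (hfin : ∀ s, (U s).Finite)
    (hres : ∀ s, ∀ a ∈ U (s + 1), ∃ b ∈ U s, ∀ i < n s, a i = b i)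
    (hsplit : ∀ s, ∀ a ∈ U s, ∃ b ∈ U (s + 1), ∃ c ∈ U (s + 1),
      (∃ i < n (s + 1), b i ≠ c i) ∧ (∀ i < n s, b i = a i) ∧ ∀ i < n s, c i = a i) :
    Perfect (branches n U) := by
  have hext : ∀ s, ∀ a ∈ U s, ∃ b ∈ U (s + 1), ∀ i < n s, b i = a i := fun s a ha =>
    let ⟨b, hb, _, _, _, h, _⟩ := hsplit s a ha
    ⟨b, hb, h⟩
  refine ⟨isClosed_branches hfin, fun η hη => accPt_iff_nhds.2 fun V hV => ?_⟩
  obtain ⟨_, ⟨ξ, N, rfl⟩, hηξ, hNV⟩ :=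
    (PiNat.isTopologicalBasis_cylinders fun _ : ℕ => Bool).mem_nhds_iff.1 hV
  obtain ⟨a, ha, hηa⟩ := hη N
  obtain ⟨b, hb, c, hc, ⟨i, hi, hbc⟩, hba, hca⟩ := hsplit N a ha
  have key : ∀ d ∈ U (N + 1), (∀ i < n N, d i = a i) →
      ∃ ζ ∈ V ∩ branches n U, ∀ i < n (N + 1), ζ i = d i := by
    intro d hd hda
    obtain ⟨ζ, hζ, hζd⟩ := exists_mem_branches_extending hn hres hext hd
    refine ⟨ζ, ⟨hNV fun j hj => ?_, hζ⟩, hζd⟩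
    have hj' : j < n N := hj.trans_le hn.le_apply
    rw [hζd j (hj'.trans (hn N.lt_succ_self)), hda j hj', ← hηa j hj', hηξ j hj]
  obtain ⟨ζ, hζ, hζb⟩ := key b hb hba
  obtain ⟨ξ', hξ', hξc⟩ := key c hc hca
  -- The two extensions differ, so at least one of them is not `η`.
  by_cases h : ζ = η
  · refine ⟨ξ', hξ', fun h' => hbc ?_⟩
    rw [← hζb i hi, ← hξc i hi, h, h']
  · exact ⟨ζ, hζ, h⟩

end Branches

/-! ### Monotonicity of the rank -/

section Rank

variable {L : FirstOrder.Language.{u, u}} {S : Symbols L} {M : Type u} [L.Structure M]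

theorem rankGE_zero : RankGE (M := M) S 0 = Homog S :=
  Ordinal.limitRecOn_zero _ _ _

theorem rankGE_add_one (α : Ordinal.{u}) {w₁ w₂ : Set M} :
    RankGE S (α + 1) w₁ w₂ ↔ Homog S w₁ w₂ ∧ Step S (RankGE S α) w₁ w₂ := by
  rw [RankGE, Ordinal.limitRecOn_add_one]
  rfl

theorem rankGE_limit {α : Ordinal.{u}} (hα : Order.IsSuccLimit α) {w₁ w₂ : Set M} :
    RankGE S α w₁ w₂ ↔ ∀ β < α, RankGE S β w₁ w₂ := by
  rw [RankGE, Ordinal.limitRecOn_limit _ _ _ _ hα]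
  rfl

theorem Step.mono {P P' : Set M → Set M → Prop} (h : ∀ v₁ v₂, P v₁ v₂ → P' v₁ v₂)
    {w₁ w₂ : Set M} (hP : Step S P w₁ w₂) : Step S P' w₁ w₂ := fun k hk ψ hψ =>
  let ⟨e, he, he'⟩ := hP k hk ψ hψ
  ⟨e, h _ _ he, he'⟩

theorem RankGE.of_add_one (α : Ordinal.{u}) :
    ∀ {w₁ w₂ : Set M}, RankGE S (α + 1) w₁ w₂ → RankGE S α w₁ w₂ := by
  induction α using Ordinal.limitRecOn with
  | zero =>
    intro w₁ w₂ h
    rw [rankGE_zero]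
    exact ((rankGE_add_one 0).1 h).1
  | add_one α ih =>
    intro w₁ w₂ h
    rw [rankGE_add_one] at h ⊢
    exact ⟨h.1, h.2.mono fun _ _ => ih⟩
  | limit α hα ih =>
    intro w₁ w₂ h
    rw [rankGE_add_one] at h
    refine (rankGE_limit hα).2 fun β hβ => ih β hβ ?_
    exact (rankGE_add_one β).2 ⟨h.1, h.2.mono fun _ _ h' => (rankGE_limit hα).1 h' β hβ⟩

theorem RankGE.mono {α β : Ordinal.{u}} (h : α ≤ β) {w₁ w₂ : Set M} (hβ : RankGE S β w₁ w₂) :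
    RankGE S α w₁ w₂ := by
  induction β using Ordinal.limitRecOn with
  | zero => rwa [nonpos_iff_eq_zero.1 h]
  | add_one β ih =>
    rcases h.eq_or_lt with rfl | h
    · exact hβ
    · exact ih (Order.lt_add_one_iff.1 h) (RankGE.of_add_one β hβ)
  | limit β hβ' _ =>
    rcases h.eq_or_lt with rfl | h
    · exact hβ
    · exact (rankGE_limit hβ').1 hβ α h

theorem rankGE_of_lt_rkrc {α : Ordinal.{u}} {w₁ w₂ : Set M}
    (h : (α : WithTop Ordinal.{u}) < rkrc S w₁ w₂) :
    RankGE S α w₁ w₂ := by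
  by_contra hα
  refine h.not_ge (csSup_le' ?_)
  rintro _ ⟨β, rfl, hβ⟩
  refine WithTop.coe_le_coe.2 (le_of_not_ge fun h' => hα (hβ.mono h'))

/-- If every pair of value `c` had rank below `α`, all the ordinals `rkrc + 1` would be at most `α`,
and so would their supremum. This is where the `+ 1` in `κ⁺ + 1` is used. -/
theorem exists_rankGE_of_lt_rkrcAt {α : Ordinal.{u}} (hα : Order.IsSuccLimit α) {c : M}
    (h : ((α + 1 : Ordinal.{u}) : WithTop Ordinal.{u}) ≤ rkrcAt S c) :
    ∃ w₁ w₂ : Set M, HomogAt S c w₁ w₂ ∧ RankGE S α w₁ w₂ := by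
  by_contra! hne
  have hle : rkrcAt S c ≤ (α : WithTop Ordinal.{u}) := by
    refine csSup_le' ?_
    rintro _ ⟨w₁, w₂, hw, rfl⟩
    have hr : ¬ ∀ β < α, RankGE S β w₁ w₂ := fun h' => hne w₁ w₂ hw ((rankGE_limit hα).2 h')
    push Not at hr
    obtain ⟨β, hβ, hβr⟩ := hr
    have h1 : rkrc S w₁ w₂ ≤ (β : WithTop Ordinal.{u}) :=
      le_of_not_gt fun h' => hβr (rankGE_of_lt_rkrc h')
    calc rkrc S w₁ w₂ + 1 ≤ (β : WithTop Ordinal.{u}) + 1 := by gcongr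
      _ = ((β + 1 : Ordinal.{u}) : WithTop Ordinal.{u}) := rfl
      _ ≤ α := WithTop.coe_le_coe.2 (Order.add_one_le_of_lt hβ)
  exact absurd (WithTop.coe_le_coe.1 (h.trans hle)) (lt_add_one α).not_ge

end Rank

/-! ### Triples of finite sequences and their number -/

/-- Triples of finite sequences of a common length. -/
abbrev Node (K : Type u) : Type u := Σ n : ℕ, (Fin n → Bool) × (Fin n → Bool) × (Fin n → K)

/-- The restriction to `n` of a triple of infinite sequences. -/
def node {K : Type u} (n : ℕ) (η ν : Real2) (r : ℕ → K) : Node K :=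
  ⟨n, fun i => η i, fun i => ν i, fun i => r i⟩

theorem node_eq_node_iff {K : Type u} {n : ℕ} {η ν η' ν' : Real2} {r r' : ℕ → K} :
    node n η ν r = node n η' ν' r' ↔
      (∀ i < n, η i = η' i) ∧ (∀ i < n, ν i = ν' i) ∧ ∀ i < n, r i = r' i := by
  simp [node, funext_iff, Fin.forall_iff]

theorem mk_node_le (K : Type u) [Infinite K] : #(Node K) ≤ #K := by
  have hinj : Function.Injective fun t : Node K =>
      (List.ofFn t.2.1, List.ofFn t.2.2.1, List.ofFn t.2.2.2) := by
    rintro ⟨n, f, g, h⟩ ⟨m, f', g', h'⟩ heq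
    simp only [Prod.mk.injEq] at heq
    obtain rfl : n = m := by simpa using congrArg List.length heq.1
    obtain ⟨h1, h2, h3⟩ := heq
    rw [List.ofFn_injective h1, List.ofFn_injective h2, List.ofFn_injective h3]
  have hK : ℵ₀ ≤ #K := aleph0_le_mk K
  have hB : #(List Bool) ≤ ℵ₀ := mk_le_aleph0
  refine (mk_le_of_injective hinj).trans ?_
  rw [mk_prod, mk_prod, mk_list_eq_mk K]
  simp only [lift_uzero]
  have hB' : Cardinal.lift.{u} #(List Bool) ≤ #K := (lift_le_aleph0.2 hB).trans hK
  exact (mul_le_mul' hB' (mul_le_mul' hB' le_rfl)).trans (by rw [mul_eq_self hK, mul_eq_self hK])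

/-! ### Fusion along an abstract rank -/

section Fusion

variable {M K : Type u} (x : M → Real2) (ρ : M → M → ℕ → K)

/-- The restrictions to `n` of the triples coming from the pairs in `W false ×ˢ W true`. -/
def approx (n : ℕ) (W : Bool → Set M) : Set (Node K) :=
  image2 (fun a b => node n (x a) (x b) (ρ a b)) (W false) (W true)

/-- Distinct elements of the same side are distinguished below `n`. -/
def Separated (n : ℕ) (W : Bool → Set M) : Prop :=
  ∀ j, ∀ a ∈ W j, ∀ b ∈ W j, (∀ i < n, x a i = x b i) → a = b

variable {x ρ}

theorem exists_mem_of_approx_eq {n : ℕ} {W W' : Bool → Set M} (h : approx x ρ n W = approx x ρ n W')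
    {a b : M} (ha : a ∈ W false) (hb : b ∈ W true) :
    ∃ a' ∈ W' false, ∃ b' ∈ W' true, (∀ i < n, x a' i = x a i) ∧ (∀ i < n, x b' i = x b i) ∧
      ∀ i < n, ρ a' b' i = ρ a b i := by
  have hab : node n (x a) (x b) (ρ a b) ∈ approx x ρ n W' := h ▸ mem_image2_of_mem ha hb
  obtain ⟨a', ha', b', hb', h'⟩ := hab
  exact ⟨a', ha', b', hb', node_eq_node_iff.1 h'⟩

theorem exists_agree_of_approx_eq {n : ℕ} {W W' : Bool → Set M} (hW : ∀ j, (W j).Nonempty)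
    (h : approx x ρ n W = approx x ρ n W') {j : Bool} {a : M} (ha : a ∈ W j) :
    ∃ a' ∈ W' j, ∀ i < n, x a' i = x a i := by
  cases j
  · obtain ⟨b, hb⟩ := hW true
    obtain ⟨a', ha', _, _, h, _⟩ := exists_mem_of_approx_eq h ha hb
    exact ⟨a', ha', h⟩
  · obtain ⟨b, hb⟩ := hW false
    obtain ⟨_, _, a', ha', _, h, _⟩ := exists_mem_of_approx_eq h hb ha
    exact ⟨a', ha', h⟩

theorem approx_subset_of_le {n m : ℕ} (hnm : n ≤ m) {W W' : Bool → Set M}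
    (h : approx x ρ m W = approx x ρ m W') : approx x ρ n W ⊆ approx x ρ n W' := by
  rintro _ ⟨a, ha, b, hb, rfl⟩
  obtain ⟨a', ha', b', hb', h1, h2, h3⟩ := exists_mem_of_approx_eq h ha hb
  exact ⟨a', ha', b', hb', node_eq_node_iff.2 ⟨fun i hi => h1 i (hi.trans_le hnm),
    fun i hi => h2 i (hi.trans_le hnm), fun i hi => h3 i (hi.trans_le hnm)⟩⟩

theorem approx_eq_of_le {n m : ℕ} (hnm : n ≤ m) {W W' : Bool → Set M}
    (h : approx x ρ m W = approx x ρ m W') : approx x ρ n W = approx x ρ n W' :=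
  (approx_subset_of_le hnm h).antisymm (approx_subset_of_le hnm h.symm)

theorem exists_separated {W : Bool → Set M} (hfin : ∀ j, (W j).Finite)
    (hinj : ∀ j, InjOn x (W j)) (n : ℕ) : ∃ m > n, Separated x m W := by
  have hd : ∀ j, ∀ p : M × M, ∃ d, p ∈ W j ×ˢ W j → (∀ i < d, x p.1 i = x p.2 i) → p.1 = p.2 := by
    intro j p
    by_cases hp : x p.1 = x p.2
    · exact ⟨0, fun h _ => hinj j h.1 h.2 hp⟩
    · obtain ⟨i, hi⟩ := Function.ne_iff.1 hp
      exact ⟨i + 1, fun _ h => absurd (h i i.lt_succ_self) hi⟩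
  choose d hd using hd
  have hb : ∀ j, ∃ m, ∀ p ∈ W j ×ˢ W j, d j p ≤ m := fun j => by
    obtain ⟨m, hm⟩ := (((hfin j).prod (hfin j)).image (d j)).bddAbove
    exact ⟨m, fun p hp => hm (mem_image_of_mem _ hp)⟩
  choose m hm using hb
  refine ⟨n + 1 + m false + m true, by omega, fun j a ha b hb h => ?_⟩
  refine hd j (a, b) ⟨ha, hb⟩ fun i hi => h i ?_
  have := hm j (a, b) ⟨ha, hb⟩
  cases j <;> omega

/-- `G α W` for `α < κ⁺` abstracts "`W` has rank at least `α`". -/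
structure IsRankNotion (x : M → Real2) (ρ : M → M → ℕ → K)
    (G : Ordinal.{u} → (Bool → Set M) → Prop) : Prop where
  mono : ∀ ⦃α β W⦄, α ≤ β → G β W → G α W
  finite : ∀ ⦃α W⦄, G α W → ∀ j, (W j).Finite
  nonempty : ∀ ⦃α W⦄, G α W → ∀ j, (W j).Nonempty
  injOn : ∀ ⦃α W⦄, G α W → ∀ j, InjOn x (W j)
  split : ∀ ⦃α W⦄, G (α + 1) W → ∀ (n : ℕ) (j : Bool), ∀ k ∈ W j, ∃ W', G α W' ∧
    approx x ρ n W' = approx x ρ n W ∧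
    ∃ a ∈ W' j, ∃ b ∈ W' j, a ≠ b ∧ (∀ i < n, x a i = x k i) ∧ ∀ i < n, x b i = x k i

/-- `W` is separated below `n`, and its approximation at `n` is realized in every rank
below `δ`. -/
structure Large (x : M → Real2) (ρ : M → M → ℕ → K) (G : Ordinal.{u} → (Bool → Set M) → Prop)
    (δ : Ordinal.{u}) (n : ℕ) (W : Bool → Set M) : Prop where
  sep : Separated x n W
  base : G 0 W
  rank : ∀ α < δ, ∃ W', approx x ρ n W' = approx x ρ n W ∧ G α W'

variable {G : Ordinal.{u} → (Bool → Set M) → Prop}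

/-- Pigeonhole on the `κ` pairs of a level and an approximation. The level `m` is known only after
the split, so the bound on bad ranks must cover all levels at once. -/
theorem Large.exists_split [Infinite K] (hG : IsRankNotion x ρ G) {n : ℕ} {W : Bool → Set M}
    (hW : Large x ρ G (Order.succ #K).ord n W) {j : Bool} {k : M} (hk : k ∈ W j) :
    ∃ m > n, ∃ W', Large x ρ G (Order.succ #K).ord m W' ∧ approx x ρ n W' = approx x ρ n W ∧
      ∃ a ∈ W' j, ∃ b ∈ W' j, a ≠ b ∧ (∀ i < n, x a i = x k i) ∧ ∀ i < n, x b i = x k i := by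
  have hK : ℵ₀ ≤ #K := aleph0_le_mk K
  set δ := (Order.succ #K).ord with hδ
  have hlim : Order.IsSuccLimit δ := isSuccLimit_ord (hK.trans (Order.le_succ _))
  have hcard : #(ℕ × Finset (Node K)) < Order.succ #K := by
    have : Infinite (Node K) := Infinite.of_injective
      (fun a : K => (⟨1, fun _ => true, fun _ => true, fun _ => a⟩ : Node K)) fun a b h => by
        simpa [funext_iff] using h
    rw [Order.lt_succ_iff, mk_prod, mk_finset_of_infinite]
    simp only [lift_uzero, mk_nat, lift_aleph0]
    exact (mul_le_mul' hK (mk_node_le K)).trans (mul_eq_self hK).le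
  -- To each approximation missing from some rank below `δ`, attach such a rank; to the others, `0`.
  have hbad : ∀ t : ℕ × Finset (Node K), ∃ α < δ,
      (∃ α' < δ, ∀ V, approx x ρ t.1 V = t.2 → ¬ G α' V) →
        ∀ V, approx x ρ t.1 V = t.2 → ¬ G α V := by
    intro t
    by_cases h : ∃ α' < δ, ∀ V, approx x ρ t.1 V = t.2 → ¬ G α' V
    · obtain ⟨α, hα, h'⟩ := h
      exact ⟨α, hα, fun _ => h'⟩
    · exact ⟨0, hlim.bot_lt, fun h' => absurd h' h⟩
  choose f hfδ hf using hbad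
  have hβ : ⨆ t, f t < δ := Ordinal.iSup_lt_of_lt_cof (by rwa [hδ, (isRegular_succ hK).cof_ord]) hfδ
  -- One more than the supremum, since the split costs one rank.
  obtain ⟨V, hVW, hV⟩ := hW.rank _ (hlim.add_one_lt hβ)
  obtain ⟨k', hk', hkk'⟩ := exists_agree_of_approx_eq (hG.nonempty hW.base) hVW.symm hk
  obtain ⟨W', hW', hWV, a, ha, b, hb, hab, hak, hbk⟩ := hG.split hV n j k' hk'
  obtain ⟨m, hm, hsep⟩ := exists_separated (hG.finite hW') (hG.injOn hW') n
  refine ⟨m, hm, W', ⟨hsep, hG.mono (zero_le) hW', ?_⟩, hWV.trans hVW, a, ha, b, hb, hab,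
    fun i hi => (hak i hi).trans (hkk' i hi), fun i hi => (hbk i hi).trans (hkk' i hi)⟩
  -- A bad approximation of `W'` would be missing from the rank `f` attaches to it, yet `W'` has
  -- rank at least `⨆ t, f t`.
  by_contra! hlow
  obtain ⟨α, hα, hlow⟩ := hlow
  have hfin : (approx x ρ m W').Finite := (hG.finite hW' false).image2 _ (hG.finite hW' true)
  refine hf (m, hfin.toFinset) ⟨α, hα, fun V' hV' => hlow V' (by simpa using hV')⟩ W' (by simp)
    (hG.mono (Ordinal.le_iSup f _) hW')

/-- Points are split one at a time. Each step replaces the whole of `W`, but pairs split earlier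
reappear in the new sets because the approximation is kept, and they stay distinct because they were
separated below the preserved level. -/
theorem Large.exists_split_all [Infinite K] (hG : IsRankNotion x ρ G) {n : ℕ} {W : Bool → Set M}
    (hW : Large x ρ G (Order.succ #K).ord n W) :
    ∃ m > n, ∃ W', Large x ρ G (Order.succ #K).ord m W' ∧ approx x ρ n W' = approx x ρ n W ∧
      ∀ j, ∀ k ∈ W j, ∃ a ∈ W' j, ∃ b ∈ W' j,
        a ≠ b ∧ (∀ i < n, x a i = x k i) ∧ ∀ i < n, x b i = x k i := by
  have key : ∀ s : Set (Bool × M), s.Finite → (∀ p ∈ s, p.2 ∈ W p.1) →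
      ∃ m > n, ∃ W', Large x ρ G (Order.succ #K).ord m W' ∧ approx x ρ n W' = approx x ρ n W ∧
      ∀ p ∈ s, ∃ a ∈ W' p.1, ∃ b ∈ W' p.1,
        a ≠ b ∧ (∀ i < n, x a i = x p.2 i) ∧ ∀ i < n, x b i = x p.2 i := by
    intro s hs
    induction s, hs using Set.Finite.induction_on with
    | empty =>
      intro _
      obtain ⟨k, hk⟩ := hG.nonempty hW.base false
      obtain ⟨m, hm, W', hW', happ, -⟩ := hW.exists_split hG hk
      exact ⟨m, hm, W', hW', happ, by simp⟩
    | @insert p s _ _ ih =>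
      intro hp
      obtain ⟨m, hm, W', hW', happ, hs⟩ := ih fun q hq => hp q (mem_insert_of_mem _ hq)
      obtain ⟨k, hk, hkp⟩ := exists_agree_of_approx_eq (hG.nonempty hW.base) happ.symm
        (hp p (mem_insert _ _))
      obtain ⟨m', hm', W'', hW'', happ', a, ha, b, hb, hab, hak, hbk⟩ := hW'.exists_split hG hk
      refine ⟨m', hm.trans hm', W'', hW'', (approx_eq_of_le hm.le happ').trans happ, ?_⟩
      rintro q (rfl | hq)
      · exact ⟨a, ha, b, hb, hab, fun i hi => (hak i (hi.trans hm)).trans (hkp i hi),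
          fun i hi => (hbk i (hi.trans hm)).trans (hkp i hi)⟩
      · obtain ⟨c, hc, d, hd, hcd, hcq, hdq⟩ := hs q hq
        obtain ⟨c', hc', hcc'⟩ := exists_agree_of_approx_eq (hG.nonempty hW'.base) happ'.symm hc
        obtain ⟨d', hd', hdd'⟩ := exists_agree_of_approx_eq (hG.nonempty hW'.base) happ'.symm hd
        refine ⟨c', hc', d', hd', ?_, fun i hi => (hcc' i (hi.trans hm)).trans (hcq i hi),
          fun i hi => (hdd' i (hi.trans hm)).trans (hdq i hi)⟩
        rintro rfl
        exact hcd (hW'.sep _ c hc d hd fun i hi => (hcc' i hi).symm.trans (hdd' i hi))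
  have hfin : {p : Bool × M | p.2 ∈ W p.1}.Finite := by
    refine ((finite_univ (α := Bool)).biUnion fun j _ =>
      (hG.finite hW.base j).image (Prod.mk j)).subset ?_
    rintro ⟨j, k⟩ hk
    cases j <;> simpa using hk
  obtain ⟨m, hm, W', hW', happ, h⟩ := key _ hfin fun p hp => hp
  exact ⟨m, hm, W', hW', happ, fun j k hk => h (j, k) hk⟩

theorem exists_perfect_of_rank [Infinite K] (hG : IsRankNotion x ρ G) {W₀ : Bool → Set M}
    (hW₀ : ∀ α < (Order.succ #K).ord, G α W₀) :
    ∃ P : Bool → Set Real2, (∀ j, Perfect (P j) ∧ (P j).Nonempty) ∧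
      ∀ η ∈ P false, ∀ ν ∈ P true, ∃ r : ℕ → K, ∀ N, ∃ W, G 0 W ∧ ∃ a ∈ W false, ∃ b ∈ W true,
        node N η ν r = node N (x a) (x b) (ρ a b) := by
  have hlim : Order.IsSuccLimit (Order.succ #K).ord :=
    isSuccLimit_ord ((aleph0_le_mk K).trans (Order.le_succ _))
  have hW₀0 : G 0 W₀ := hW₀ 0 hlim.bot_lt
  obtain ⟨n₀, -, hsep₀⟩ := exists_separated (hG.finite hW₀0) (hG.injOn hW₀0) 0
  let C := {p : ℕ × (Bool → Set M) // Large x ρ G (Order.succ #K).ord p.1 p.2}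
  have hnext : ∀ p : C, ∃ q : C, p.1.1 < q.1.1 ∧ approx x ρ p.1.1 q.1.2 = approx x ρ p.1.1 p.1.2 ∧
      ∀ j, ∀ k ∈ p.1.2 j, ∃ a ∈ q.1.2 j, ∃ b ∈ q.1.2 j,
        a ≠ b ∧ (∀ i < p.1.1, x a i = x k i) ∧ ∀ i < p.1.1, x b i = x k i := by
    rintro ⟨⟨n, W⟩, hW⟩
    obtain ⟨m, hm, W', hW', h⟩ := hW.exists_split_all hG
    exact ⟨⟨(m, W'), hW'⟩, hm, h⟩
  choose g hgn hga hgs using hnext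
  let c : ℕ → C := fun s =>
    Nat.rec ⟨(n₀, W₀), hsep₀, hW₀0, fun α hα => ⟨W₀, rfl, hW₀ α hα⟩⟩ (fun _ p => g p) s
  let n : ℕ → ℕ := fun s => (c s).1.1
  let W : ℕ → Bool → Set M := fun s => (c s).1.2
  have hL : ∀ s, Large x ρ G (Order.succ #K).ord (n s) (W s) := fun s => (c s).2
  have hn : StrictMono n := strictMono_nat_of_lt_succ fun s => hgn (c s)
  have happ : ∀ s, approx x ρ (n s) (W (s + 1)) = approx x ρ (n s) (W s) := fun s => hga (c s)
  have hsplit : ∀ s j, ∀ k ∈ W s j, ∃ a ∈ W (s + 1) j, ∃ b ∈ W (s + 1) j,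
      a ≠ b ∧ (∀ i < n s, x a i = x k i) ∧ ∀ i < n s, x b i = x k i := fun s => hgs (c s)
  have hne : ∀ s j, (W s j).Nonempty := fun s => hG.nonempty (hL s).base
  have hres : ∀ j s, ∀ η ∈ x '' W (s + 1) j, ∃ ν ∈ x '' W s j, ∀ i < n s, η i = ν i := by
    rintro j s _ ⟨a, ha, rfl⟩
    obtain ⟨b, hb, h⟩ := exists_agree_of_approx_eq (hne (s + 1)) (happ s) ha
    exact ⟨_, mem_image_of_mem x hb, fun i hi => (h i hi).symm⟩
  have hsplit' : ∀ j s, ∀ η ∈ x '' W s j, ∃ ν ∈ x '' W (s + 1) j, ∃ ξ ∈ x '' W (s + 1) j,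
      (∃ i < n (s + 1), ν i ≠ ξ i) ∧ (∀ i < n s, ν i = η i) ∧ ∀ i < n s, ξ i = η i := by
    rintro j s _ ⟨k, hk, rfl⟩
    obtain ⟨a, ha, b, hb, hab, h⟩ := hsplit s j k hk
    refine ⟨_, mem_image_of_mem x ha, _, mem_image_of_mem x hb, ?_, h⟩
    by_contra! h'
    exact hab ((hL (s + 1)).sep j a ha b hb h')
  refine ⟨fun j => branches n fun s => x '' W s j, fun j => ⟨?_, ?_⟩, ?_⟩
  · exact perfect_branches hn (fun s => (hG.finite (hL s).base j).image x) (hres j) (hsplit' j)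
  · obtain ⟨k, hk⟩ := hne 0 j
    obtain ⟨η, hη, -⟩ := exists_mem_branches_extending hn (hres j)
      (fun s a ha => let ⟨b, hb, _, _, _, h, _⟩ := hsplit' j s a ha; ⟨b, hb, h⟩)
      (s := 0) (mem_image_of_mem x hk)
    exact ⟨η, hη⟩
  · intro η hη ν hν
    simp only [branches, exists_mem_image, mem_ofPred_eq] at hη hν
    choose a ha hηa using hη
    choose b hb hνb using hν
    -- The triple of stage `s + 1`, cut at `n s`, comes from a pair of stage `s`; separation forces
    -- this pair to be `(a s, b s)`.
    have hρ : ∀ s, ∀ i < n s, ρ (a (s + 1)) (b (s + 1)) i = ρ (a s) (b s) i := by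
      intro s i hi
      have hs : n s < n (s + 1) := hn s.lt_succ_self
      obtain ⟨a', ha', b', hb', h1, h2, h3⟩ :=
        exists_mem_of_approx_eq (happ s) (ha (s + 1)) (hb (s + 1))
      obtain rfl : a' = a s := (hL s).sep false _ ha' _ (ha s) fun i hi => by
        rw [h1 i hi, ← hηa s i hi, hηa (s + 1) i (hi.trans hs)]
      obtain rfl : b' = b s := (hL s).sep true _ hb' _ (hb s) fun i hi => by
        rw [h2 i hi, ← hνb s i hi, hνb (s + 1) i (hi.trans hs)]
      exact (h3 i hi).symm
    have hρ' : ∀ s t, s ≤ t → ∀ i < n s, ρ (a t) (b t) i = ρ (a s) (b s) i := by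
      intro s t hst i hi
      induction t, hst using Nat.le_induction with
      | base => rfl
      | succ t hst ih => rw [hρ t i (hi.trans_le (hn.monotone hst)), ih]
    refine ⟨fun i => ρ (a (i + 1)) (b (i + 1)) i, fun N => ⟨W N, (hL N).base, a N, ha N, b N, hb N,
      node_eq_node_iff.2 ⟨fun i hi => hηa N i (hi.trans_le hn.le_apply),
        fun i hi => hνb N i (hi.trans_le hn.le_apply), fun i hi => ?_⟩⟩⟩
    exact (hρ' (i + 1) N hi i (lt_of_lt_of_le i.lt_succ_self hn.le_apply)).symm

end Fusion

/-! ### The model-theoretic rank as an abstract rank -/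

section RankNotion

variable {L : FirstOrder.Language.{u, u}} {S : Symbols L} {M K : Type u} [L.Structure M]
  {x : M → Real2} {ρ : M → M → ℕ → K}

/-- The formulas fed to the rank are those naming the triple of each pair at level `n`, so the two
copies keep the approximation. Injectivity is needed only on each side, so the two sides may share
reals. -/
theorem isRankNotion_rankGE {c : M} (hx₁ : InjOn x (S.r₁ M)) (hx₂ : InjOn x (S.r₂ M))
    (hψ : ∀ t : Node K, ∃ ψ : L.Formula (Fin 2), ψ.IsQF ∧
      ∀ a b : M, ψ.Realize ![a, b] ↔ node t.1 (x a) (x b) (ρ a b) = t) :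
    IsRankNotion x ρ fun α W =>
      RankGE S α (W false) (W true) ∧ HomogAt S c (W false) (W true) where
  mono _ _ _ h hW := ⟨hW.1.mono h, hW.2⟩
  finite _ _ hW j := by cases j; exacts [hW.2.1.1, hW.2.2.1.1]
  nonempty _ _ hW j := by cases j; exacts [hW.2.1.2.1, hW.2.2.1.2.1]
  injOn _ _ hW j := by cases j; exacts [hx₁.mono hW.2.1.2.2, hx₂.mono hW.2.2.1.2.2]
  split := by
    rintro α W ⟨hW, ⟨hfin₁, hne₁, -⟩, ⟨hfin₂, hne₂, -⟩, hc⟩ n j k hk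
    choose ψ hQF hψ using hψ
    have hkW : k ∈ W false ∪ W true := by cases j; exacts [Or.inl hk, Or.inr hk]
    obtain ⟨e, hP, he, ⟨hek, hk₁, hk₂⟩, hf⟩ := ((rankGE_add_one α).1 hW).2 k hkW
      (fun a b => ψ (node n (x a) (x b) (ρ a b))) fun a _ b _ => ⟨hQF _, (hψ _ _ _).2 rfl⟩
    have hnode : ∀ i, ∀ a ∈ W false, ∀ b ∈ W true,
        node n (x (e i a)) (x (e i b)) (ρ (e i a) (e i b)) = node n (x a) (x b) (ρ a b) :=
      fun i a ha b hb => (hψ _ _ _).1 ((he i).2.2.2 a ha b hb)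
    -- The formulas control only pairs within one copy. As the side opposite to `k` is the same in
    -- both copies, every mixed pair is such a pair.
    have hcross : ∀ i i', ∀ a ∈ W false, ∀ b ∈ W true,
        node n (x (e i a)) (x (e i' b)) (ρ (e i a) (e i' b)) = node n (x a) (x b) (ρ a b) := by
      intro i i' a ha b hb
      have heq : ∀ m, e 0 m = e 1 m → e i m = e i' m := by
        intro m hm
        fin_cases i <;> fin_cases i' <;> simp [hm]
      cases j
      · rw [← heq b (hk₁ hk b hb)]
        exact hnode i a ha b hb
      · rw [heq a (hk₂ hk a ha)]
        exact hnode i' a ha b hb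
    have hagree : ∀ i, ∀ l < n, x (e i k) l = x k l := by
      intro i
      cases j
      · obtain ⟨b, hb⟩ := hne₂
        exact (node_eq_node_iff.1 (hnode i k hk b hb)).1
      · obtain ⟨a, ha⟩ := hne₁
        exact (node_eq_node_iff.1 (hnode i a ha k hk)).2.1
    refine ⟨fun j => ⋃ i, e i '' W j, ⟨hP, ⟨?_, ?_, ?_⟩, ⟨?_, ?_, ?_⟩, ?_⟩, ?_, e 0 k, ?_, e 1 k, ?_,
      hek, hagree 0, hagree 1⟩
    · exact finite_iUnion fun i => hfin₁.image _
    · exact nonempty_iUnion.2 ⟨0, hne₁.image _⟩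
    · exact iUnion_subset fun i => (he i).2.1.image_subset
    · exact finite_iUnion fun i => hfin₂.image _
    · exact nonempty_iUnion.2 ⟨0, hne₂.image _⟩
    · exact iUnion_subset fun i => (he i).2.2.1.image_subset
    · intro a' ha' b' hb'
      obtain ⟨i, a, ha, rfl⟩ := mem_iUnion.1 ha'
      obtain ⟨i', b, hb, rfl⟩ := mem_iUnion.1 hb'
      rw [hf a ha b hb, hc a ha b hb]
    · apply Subset.antisymm
      · rintro _ ⟨a', ha', b', hb', rfl⟩
        obtain ⟨i, a, ha, rfl⟩ := mem_iUnion.1 ha'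
        obtain ⟨i', b, hb, rfl⟩ := mem_iUnion.1 hb'
        exact ⟨a, ha, b, hb, (hcross i i' a ha b hb).symm⟩
      · rintro _ ⟨a, ha, b, hb, rfl⟩
        exact ⟨e 0 a, mem_iUnion.2 ⟨0, mem_image_of_mem _ ha⟩, e 0 b,
          mem_iUnion.2 ⟨0, mem_image_of_mem _ hb⟩, hnode 0 a ha b hb⟩
    · exact mem_iUnion.2 ⟨0, mem_image_of_mem _ hk⟩
    · exact mem_iUnion.2 ⟨1, mem_image_of_mem _ hk⟩

end RankNotion

/-! ### The model of a rectangle -/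

/-- The function symbols of the vocabulary of a rectangle. -/
inductive RectFunctions : ℕ → Type u
  | F : RectFunctions 2

/-- The relation symbols of the vocabulary of a rectangle: besides the three sorts, a binary
relation for each triple of finite sequences. -/
inductive RectRelations (K : Type u) : ℕ → Type u
  | R₁ : RectRelations K 1
  | R₂ : RectRelations K 1
  | Q : RectRelations K 1
  | node (t : Node K) : RectRelations K 2

/-- The vocabulary of a rectangle. -/
def rectLanguage (K : Type u) : FirstOrder.Language.{u, u} := ⟨RectFunctions, RectRelations K⟩

/-- The distinguished symbols of `rectLanguage K`. -/
def rectSymbols (K : Type u) : Symbols (rectLanguage K) where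
  R₁ := RectRelations.R₁
  R₂ := RectRelations.R₂
  Q := RectRelations.Q
  F := RectFunctions.F

theorem card_rectLanguage_le (K : Type u) [Infinite K] : (rectLanguage K).card ≤ #K := by
  have hK : ℵ₀ ≤ #K := aleph0_le_mk K
  let g : ULift.{u} (Fin 4) ⊕ Node K → (rectLanguage K).Symbols
    | .inl ⟨0⟩ => .inl ⟨2, RectFunctions.F⟩
    | .inl ⟨1⟩ => .inr ⟨1, RectRelations.R₁⟩
    | .inl ⟨2⟩ => .inr ⟨1, RectRelations.R₂⟩
    | .inl ⟨3⟩ => .inr ⟨1, RectRelations.Q⟩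
    | .inr t => .inr ⟨2, RectRelations.node t⟩
  have hg : Function.Surjective g := by
    rintro (⟨_, ⟨⟩⟩ | ⟨_, ⟨⟩⟩)
    exacts [⟨.inl ⟨0⟩, rfl⟩, ⟨.inl ⟨1⟩, rfl⟩, ⟨.inl ⟨2⟩, rfl⟩, ⟨.inl ⟨3⟩, rfl⟩, ⟨.inr _, rfl⟩]
  refine (mk_le_of_surjective hg).trans ?_
  rw [mk_sum]
  simp only [lift_id]
  exact add_le_of_le hK ((lt_aleph0_of_finite _).le.trans hK) (mk_node_le K)

section RectModel

variable {A₁ A₂ : Set Real2} {I K : Type u}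

/-- The carrier of the model attached to a rectangle `A₁ ×ˢ A₂`. -/
abbrev RectCarrier (A₁ A₂ : Set Real2) (I : Type u) : Type u := ULift.{u} A₁ ⊕ ULift.{u} A₂ ⊕ I

/-- The real underlying an element of the model. -/
def RectCarrier.real : RectCarrier A₁ A₂ I → Real2
  | .inl a => a.down
  | .inr (.inl b) => b.down
  | .inr (.inr _) => fun _ => false

/-- The extension of a function on `A₁ × A₂` to the model. -/
def RectCarrier.extend {X : Type*} (g : A₁ → A₂ → X) (d : RectCarrier A₁ A₂ I → X) :
    RectCarrier A₁ A₂ I → RectCarrier A₁ A₂ I → X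
  | .inl a, .inr (.inl b) => g a.down b.down
  | a, _ => d a

/-- The model attached to a rectangle `A₁ ×ˢ A₂`, to a colouring `ι` of it and to a sequence
`ρ a b` for each of its points. -/
@[reducible]
def rectStructure (ι : A₁ → A₂ → I) (ρ : RectCarrier A₁ A₂ I → RectCarrier A₁ A₂ I → ℕ → K) :
    (rectLanguage K).Structure (RectCarrier A₁ A₂ I) where
  funMap
    | RectFunctions.F => fun v =>
      RectCarrier.extend (fun a b => (.inr (.inr (ι a b)) : RectCarrier A₁ A₂ I)) id (v 0) (v 1)
  RelMap
    | RectRelations.R₁ => fun v => v 0 ∈ range Sum.inl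
    | RectRelations.R₂ => fun v => v 0 ∈ range (Sum.inr ∘ Sum.inl)
    | RectRelations.Q => fun v => v 0 ∈ range (Sum.inr ∘ Sum.inr)
    | RectRelations.node t => fun v => node t.1 (v 0).real (v 1).real (ρ (v 0) (v 1)) = t

end RectModel

/-! ### Conclusion -/

theorem ContainsRectangle.containsPerfectRectangle {κ θ lam₁ lam₂ : Cardinal.{u}} (hκ : ℵ₀ ≤ κ)
    {φ : Set (Real2 × Real2)}
    {Φ : θ.ord.ToType → Set (Real2 × Real2)}
    (hΦ : ∀ i, IsSouslin κ (Φ i)) (hφ : φ = ⋃ i, Φ i)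
    (hrect : ContainsRectangle lam₁ lam₂ φ)
    (hPrrd : Prrd ((Order.succ κ).ord + 1) lam₁ lam₂ κ θ) :
    ContainsPerfectRectangle φ := by
  have hK : #κ.ord.ToType = κ := mk_ord_toType κ
  have : Infinite κ.ord.ToType := infinite_iff.2 (hκ.trans hK.ge)
  obtain ⟨A₁, A₂, h₁, h₂, hA⟩ := hrect
  choose T hT using hΦ
  have hwit : ∀ (a : A₁) (b : A₂), ∃ i, ∃ ρ : ℕ → κ.ord.ToType, (a.1, b.1, ρ) ∈ (T i).lim := by
    intro a b
    have hab : (a.1, b.1) ∈ φ := hA ⟨a.2, b.2⟩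
    rw [hφ] at hab
    obtain ⟨i, hi⟩ := mem_iUnion.1 hab
    rw [hT i] at hi
    exact ⟨i, hi⟩
  choose ι ρ₀ hρ₀ using hwit
  -- The value off `A₁ × A₂` is immaterial: the sets in the fusion stay inside the two sides.
  let ρ := RectCarrier.extend (I := θ.ord.ToType) ρ₀ fun _ _ => Classical.arbitrary κ.ord.ToType
  let _ := rectStructure ι ρ
  let S := rectSymbols κ.ord.ToType
  let M := RectCarrier A₁ A₂ θ.ord.ToType
  have hr₁ : S.r₁ M = range Sum.inl := rfl
  have hr₂ : S.r₂ M = range (Sum.inr ∘ Sum.inl) := rfl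
  have hq : S.q M = range (Sum.inr ∘ Sum.inr) := rfl
  have hmodel : IsRectModel S M lam₁ lam₂ θ := by
    refine ⟨?_, ?_, ?_, ?_, ?_⟩
    · rw [hr₁, mk_range_eq _ Sum.inl_injective, mk_uLift, h₁]
    · rw [hr₂, mk_range_eq _ (Sum.inr_injective.comp Sum.inl_injective), mk_uLift, h₂]
    · rw [hr₁, hr₂, disjoint_left]
      rintro _ ⟨a, rfl⟩ ⟨b, hb⟩
      simp at hb
    · rw [hq, mk_range_eq _ (Sum.inr_injective.comp Sum.inr_injective), mk_ord_toType]
    · rintro _ ⟨a, rfl⟩ _ ⟨b, rfl⟩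
      exact ⟨ι a.down b.down, rfl⟩
  obtain ⟨c, ⟨i, rfl⟩, hc⟩ := hPrrd (rectLanguage κ.ord.ToType) S M
    ((card_rectLanguage_le _).trans hK.le) hmodel
  have hlim : Order.IsSuccLimit (Order.succ κ).ord := isSuccLimit_ord (hκ.trans (Order.le_succ _))
  obtain ⟨w₁, w₂, hw, hrank⟩ := exists_rankGE_of_lt_rkrcAt hlim hc
  have hG : IsRankNotion RectCarrier.real ρ fun α W =>
      RankGE S α (W false) (W true) ∧ HomogAt S (.inr (.inr i) : M) (W false) (W true) := by
    refine isRankNotion_rankGE ?_ ?_ fun t => ?_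
    · rw [hr₁]
      rintro _ ⟨a, rfl⟩ _ ⟨b, rfl⟩ h
      exact congrArg Sum.inl (ULift.down_injective (Subtype.ext h))
    · rw [hr₂]
      rintro _ ⟨a, rfl⟩ _ ⟨b, rfl⟩ h
      exact congrArg (Sum.inr ∘ Sum.inl) (ULift.down_injective (Subtype.ext h))
    · let R : (rectLanguage κ.ord.ToType).Relations 2 := RectRelations.node t
      refine ⟨R.formula₂ (.var 0) (.var 1),
        (FirstOrder.Language.BoundedFormula.IsAtomic.rel _ _).isQF, fun a b => ?_⟩
      rw [FirstOrder.Language.Formula.realize_rel₂]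
      rfl
  obtain ⟨P, hP, hPr⟩ := exists_perfect_of_rank (W₀ := fun j => cond j w₂ w₁) hG fun α hα =>
    ⟨hrank.mono (by rw [hK] at hα; exact hα.le), hw⟩
  refine ⟨P false, P true, (hP _).1, (hP _).2, (hP _).1, (hP _).2, ?_⟩
  rintro ⟨η, ν⟩ ⟨hη, hν⟩
  obtain ⟨r, hr⟩ := hPr η hη ν hν
  rw [hφ]
  refine mem_iUnion.2 ⟨i, ?_⟩
  rw [hT i]
  refine ⟨r, fun N => ?_⟩
  obtain ⟨W, ⟨-, hW₁, hW₂, hWc⟩, a, ha, b, hb, hab⟩ := hr N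
  have hfc := hWc a ha b hb
  obtain ⟨a, rfl⟩ := hW₁.2.2 ha
  obtain ⟨b, rfl⟩ := hW₂.2.2 hb
  -- Homogeneity with value `i` ensures that the witness of this pair runs through the single tree
  -- `T i`.
  have hi : ι a.down b.down = i := Sum.inr_injective (Sum.inr_injective hfc)
  have hmem := hρ₀ a.down b.down N
  rw [hi] at hmem
  change node N η ν r ∈ T i
  rw [hab]
  exact hmem

end RectRank

theorem claim4p6 (κ θ lam₁ lam₂ : Cardinal.{u}) (hκ : ℵ₀ ≤ κ)
    (φ : Set (RectRank.Real2 × RectRank.Real2))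
    (Φ : θ.ord.ToType → Set (RectRank.Real2 × RectRank.Real2))
    (hΦ : ∀ i, RectRank.IsSouslin κ (Φ i)) (hφ : φ = ⋃ i, Φ i)
    (hrect : RectRank.ContainsRectangle lam₁ lam₂ φ)
    (hPrrd : RectRank.Prrd ((Order.succ κ).ord + 1) lam₁ lam₂ κ θ) :
    RectRank.ContainsPerfectRectangle φ :=
  hrect.containsPerfectRectangle hκ hΦ hφ hPrrd
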